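/- All mapping spaces carry the compact-open topology. A continuous map $p:Y\to X$ is a semicovering map (in Brazas's sense) if it is a local homeomorphism and, for every $y\in Y$, composition with $p$ is a homeomorphism from $\{f\in C([0,1],Y): f(0)=y\}$ onto $\{f\in C([0,1],X): f(0)=p(y)\}$ and also a homeomorphism from $\{f\in C(D^2,Y): f(1,0)=y\}$ onto $\{f\in C(D^2,X): f(1,0)=p(y)\}$, where $D^2$ is the closed unit disk in the plane. For a point $x$ of a topological space $X$, let the small subgroup $\pi_1^{s}(X,x)\le\pi_1(X,x)$ consist of the classes of loops at $x$ that, for every open neighborhood $U$ of $x$, are homotopic (relative to the endpoints) to a loop in $U$. Let the small generated subgroup $\pi_1^{sg}(X,x)\le\pi_1(X,x)$ be the subgroup generated by all $[\alpha*\beta*\alpha^{-1}]$, where $\alpha$ is a path in $X$ starting at $x$ and $\beta$ is a loop with $[\beta]\in\pi_1^{s}(X,\alpha(1))$. The space $X$ is semilocally small generated if every $x\in X$ has an open neighborhood $U$ with $i_*\pi_1(U,x)\le\pi_1^{sg}(X,x)$, where $i:U\hookrightarrow X$ is the inclusion. Theorem. Let $X$ be a (non-empty) connected, locally path connected and semilocally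 small generated space, and let $p:Y\to X$ be a semicovering map. Then $p$ is a covering map: every point of $X$ has an open neighborhood $U$ such that $p^{-1}(U)$ is a disjoint union of open sets each mapped homeomorphically onto $U$ by $p$. Moreover, $p$ is surjective if $Y\neq\varnothing$. -/

import Mathlib

open scoped unitInterval

/-- The space of continuous maps `f : K → Z` with `f k₀ = z`, as a subspace of `C(K, Z)` with the
compact-open topology. -/
abbrev BasedMaps (K : Type*) [TopologicalSpace K] (k₀ : K) (Z : Type*) [TopologicalSpace Z]
    (z : Z) : Type _ :=
  {f : C(K, Z) // f k₀ = z}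

/-- Composition with `p : Y → X`, from the maps `K → Y` sending `k₀` to `y` to the maps `K → X`
sending `k₀` to `p y`. -/
def BasedMaps.postcomp {K Y X : Type*} [TopologicalSpace K] [TopologicalSpace Y]
    [TopologicalSpace X] (k₀ : K) (p : C(Y, X)) (y : Y) (f : BasedMaps K k₀ Y y) :
    BasedMaps K k₀ X (p y) :=
  ⟨p.comp f.1, congrArg p f.2⟩

/-- The closed unit disk in the plane. -/
abbrev UnitDisk : Type := Metric.closedBall (0 : ℂ) 1

/-- The point `(1, 0)` of the closed unit disk. -/
def UnitDisk.basepoint : UnitDisk := ⟨1, by simp⟩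

/-- A semicovering map: a local homeomorphism with continuous lifting of paths and
homotopies. Here `p : Y → X` has continuous lifting of paths if, for every `y`, composition with `p`
is a homeomorphism from the space of paths in `Y` starting at `y` onto the space of paths in `X`
starting at `p y`; it has continuous lifting of homotopies if the same holds for maps from the
closed unit disk, based at `(1, 0)`, in place of paths. All mapping spaces carry the compact-open
topology. -/
structure IsSemicoveringMap {Y X : Type*} [TopologicalSpace Y] [TopologicalSpace X]
    (p : C(Y, X)) : Prop where
  isLocalHomeomorph : IsLocalHomeomorph p
  continuous_path_lifting :
    ∀ y : Y, IsHomeomorph (BasedMaps.postcomp (0 : I) p y)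
  continuous_homotopy_lifting :
    ∀ y : Y, IsHomeomorph (BasedMaps.postcomp UnitDisk.basepoint p y)

/-- The subgroup `i_* π₁(U, x)` of `π₁(X, x)`, where `i : U → X` is the inclusion. -/
noncomputable def inclusionImage {X : Type*} [TopologicalSpace X] (U : Set X) (x : X) (hx : x ∈ U) :
    Subgroup (FundamentalGroup X x) :=
  (FundamentalGroup.map (⟨Subtype.val, continuous_subtype_val⟩ : C(U, X)) ⟨x, hx⟩).range

/-- The small subgroup `π₁ˢ(X, x)`: the classes of loops at `x` which, for every open neighborhood
`U` of `x`, are homotopic relative to the endpoints to a loop in `U`. -/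
noncomputable def smallSubgroup {X : Type*} [TopologicalSpace X] (x : X) : Subgroup (FundamentalGroup X x) :=
  ⨅ (U : Set X) (_ : IsOpen U) (hx : x ∈ U), inclusionImage U x hx

/-- The small generated subgroup `π₁ˢᵍ(X, x)`: generated by all classes `[α * β * α⁻¹]`, where `α`
is a path starting at `x` and `β` is a loop at the endpoint of `α` whose class belongs to the small
subgroup there. -/
noncomputable def smallGeneratedSubgroup {X : Type*} [TopologicalSpace X] (x : X) :
    Subgroup (FundamentalGroup X x) :=
  Subgroup.closure
    {g | ∃ (y : X) (α : Path x y) (β : Path y y),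
      FundamentalGroup.fromPath (Path.Homotopic.Quotient.mk β) ∈ smallSubgroup y ∧
      g = FundamentalGroup.fromPath
        (Path.Homotopic.Quotient.mk ((α.trans β).trans α.symm))}

/-- `X` is semilocally small generated: every `x` has an open neighborhood `U` with
`i_* π₁(U, x) ≤ π₁ˢᵍ(X, x)`. -/
def SemilocallySmallGenerated (X : Type*) [TopologicalSpace X] : Prop :=
  ∀ x : X, ∃ (U : Set X) (hx : x ∈ U), IsOpen U ∧ inclusionImage U x hx ≤ smallGeneratedSubgroup x

/-! Paths lift uniquely along `p`, and homotopic paths lift with the same endpoints. A small loop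
can be deformed into a neighborhood over which `p` has a local section, so all its lifts are closed.
This property survives conjugation by paths, products and inverses, hence holds on the small
generated subgroup. If loops in `U` lie there, two points of one path component over `U` with the
same image must coincide, so these components are sheets. -/

/-- The path `γ` has a lift along `p` from `e` to `e'`. -/
def Path.LiftsTo {X Y : Type*} [TopologicalSpace X] [TopologicalSpace Y] (p : C(Y, X)) {a b : X}
    (γ : Path a b) (e e' : Y) : Prop :=
  ∃ δ : Path e e', ∀ t, p (δ t) = γ t

namespace Path.LiftsTo

variable {X Y : Type*} [TopologicalSpace X] [TopologicalSpace Y] {p : C(Y, X)} {a b c : X}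
  {e e' e'' : Y}

theorem source_eq {γ : Path a b} (h : γ.LiftsTo p e e') : p e = a := by
  obtain ⟨δ, hδ⟩ := h
  simpa using hδ 0

theorem refl (h : p e = a) : (Path.refl a).LiftsTo p e e :=
  ⟨Path.refl e, fun _ => h⟩

theorem symm {γ : Path a b} (h : γ.LiftsTo p e e') : γ.symm.LiftsTo p e' e := by
  obtain ⟨δ, hδ⟩ := h
  exact ⟨δ.symm, fun t => hδ _⟩

theorem trans {γ : Path a b} {γ' : Path b c} (h : γ.LiftsTo p e e') (h' : γ'.LiftsTo p e' e'') :
    (γ.trans γ').LiftsTo p e e'' := by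
  obtain ⟨δ, hδ⟩ := h
  obtain ⟨δ', hδ'⟩ := h'
  refine ⟨δ.trans δ', fun t => ?_⟩
  simp only [Path.trans_apply]
  split_ifs
  · exact hδ _
  · exact hδ' _

end Path.LiftsTo

namespace IsSemicoveringMap

variable {X Y : Type*} [TopologicalSpace X] [TopologicalSpace Y] {p : C(Y, X)}

theorem eq_of_comp_eq (hp : IsSemicoveringMap p) {f g : C(I, Y)} (h₀ : f 0 = g 0)
    (h : ∀ t, p (f t) = p (g t)) : f = g := by
  have := (hp.continuous_path_lifting (g 0)).injective (a₁ := ⟨f, h₀⟩) (a₂ := ⟨g, rfl⟩)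
    (Subtype.ext (ContinuousMap.ext h))
  exact congrArg Subtype.val this

theorem eq_of_comp_const (hp : IsSemicoveringMap p) {f : C(I, Y)} {a : X}
    (h : ∀ t, p (f t) = a) (s t : I) : f s = f t := by
  have := hp.eq_of_comp_eq (f := f) (g := ContinuousMap.const I (f 0)) rfl
    (fun t => (h t).trans (h 0).symm)
  rw [this]
  rfl

theorem exists_liftsTo (hp : IsSemicoveringMap p) {a b : X} (γ : Path a b) {e : Y} (he : p e = a) :
    ∃ e', γ.LiftsTo p e e' := by
  subst he
  obtain ⟨⟨f, rfl⟩, hf⟩ := (hp.continuous_path_lifting e).surjective ⟨γ.toContinuousMap, γ.source⟩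
  refine ⟨f 1, ⟨f, rfl, rfl⟩, fun t => ?_⟩
  exact DFunLike.congr_fun (congrArg Subtype.val hf) t

theorem liftsTo_unique (hp : IsSemicoveringMap p) {a b : X} {γ : Path a b} {e e' e'' : Y}
    (h' : γ.LiftsTo p e e') (h'' : γ.LiftsTo p e e'') : e' = e'' := by
  obtain ⟨δ', h'⟩ := h'
  obtain ⟨δ'', h''⟩ := h''
  have := hp.eq_of_comp_eq (f := δ'.toContinuousMap) (g := δ''.toContinuousMap)
    (δ'.source.trans δ''.source.symm) (fun t => (h' t).trans (h'' t).symm)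
  exact δ'.target.symm.trans ((DFunLike.congr_fun this 1).trans δ''.target)

/-- Maps on the square which are constant on a side lift to maps which are constant on that side. -/
theorem exists_lift_square (hp : IsSemicoveringMap p) (F : C(I × I, X)) {e : Y}
    (he : ∀ s, F (s, 0) = p e) :
    ∃ G : C(I × I, Y), (∀ z, p (G z) = F z) ∧ ∀ s, G (s, 0) = e := by
  -- `j` embeds the square in the disk, centered at 0, with the side `t = 0` on the line `re = 1/2`;
  -- the retraction `r` collapses the cap `re ≥ 1/2`, which contains the basepoint, onto that side.
  let r : C(UnitDisk, I × I) :=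
    ⟨fun z => (Set.projIcc 0 1 zero_le_one (z.1.im + 1 / 2),
      Set.projIcc 0 1 zero_le_one (1 / 2 - z.1.re)), by fun_prop⟩
  let j : C(I × I, UnitDisk) :=
    ⟨fun z => ⟨⟨1 / 2 - z.2, z.1 - 1 / 2⟩, by
      have h₁ := z.1.2.1
      have h₁' := z.1.2.2
      have h₂ := z.2.2.1
      have h₂' := z.2.2.2
      rw [mem_closedBall_zero_iff, Complex.norm_def, Complex.normSq_mk, Real.sqrt_le_iff]
      constructor <;> nlinarith⟩, by
      refine Continuous.subtype_mk ?_ _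
      exact Complex.equivRealProdCLM.symm.continuous.comp
        (f := fun z : I × I => ((1 / 2 - z.2, z.1 - 1 / 2) : ℝ × ℝ)) (by fun_prop)⟩
  have hrj : ∀ z, r (j z) = z := fun z => by
    simp [r, j]
  have hr : ∀ z : UnitDisk, 1 / 2 ≤ z.1.re → F (r z) = p e := fun z hz => by
    rw [← he (r z).1]
    exact congrArg F (Prod.ext rfl (Set.projIcc_of_le_left zero_le_one (by linarith)))
  obtain ⟨⟨g, hg₀⟩, hg⟩ := (hp.continuous_homotopy_lifting e).surjective
    ⟨F.comp r, hr _ (by norm_num [UnitDisk.basepoint])⟩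
  have hg : ∀ z, p (g z) = F (r z) := DFunLike.congr_fun (congrArg Subtype.val hg)
  refine ⟨g.comp j, fun z => by rw [ContinuousMap.comp_apply, hg, hrj], fun s => ?_⟩
  -- The segment from the basepoint to `j (s, 0)` stays in the cap, where `F ∘ r` is constant, so
  -- `g` is constant along it.
  let τ : C(I, UnitDisk) :=
    ⟨fun t => ⟨AffineMap.lineMap (1 : ℂ) (j (s, 0)).1 (t : ℝ),
      (convex_closedBall (0 : ℂ) 1).lineMap_mem UnitDisk.basepoint.2 (j (s, 0)).2 t.2⟩, by
      simp only [AffineMap.lineMap_apply]; fun_prop⟩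
  have hτ : ∀ t, p (g (τ t)) = p e := fun t => by
    rw [hg]
    refine hr _ ?_
    have := t.2.2
    simp [τ, j, AffineMap.lineMap_apply]
    linarith
  have hτ₀ : τ 0 = UnitDisk.basepoint := Subtype.ext (by simp [τ, UnitDisk.basepoint])
  have hτ₁ : τ 1 = j (s, 0) := Subtype.ext (by simp [τ])
  have := hp.eq_of_comp_const (f := g.comp τ) hτ 1 0
  simpa [hτ₀, hτ₁, hg₀] using this

/-- In the lifted homotopy, the side over the endpoint `b` lifts a constant path, so it is constant.
-/
theorem liftsTo_of_homotopic (hp : IsSemicoveringMap p) {a b : X} {γ₀ γ₁ : Path a b} {e e' : Y}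
    (h : γ₀.LiftsTo p e e') (hγ : γ₀.Homotopic γ₁) : γ₁.LiftsTo p e e' := by
  obtain ⟨F⟩ := hγ
  have ha := h.source_eq
  obtain ⟨G, hG, hG₀⟩ := hp.exists_lift_square F.toContinuousMap (e := e)
    (fun s => (F.source s).trans ha.symm)
  have hG₁ : ∀ s, G (s, 1) = G (0, 1) := fun s =>
    hp.eq_of_comp_const (f := G.comp ⟨fun s => (s, 1), by fun_prop⟩) (a := b)
      (fun s => (hG _).trans (F.target s)) s 0
  have h₀ : γ₀.LiftsTo p e (G (0, 1)) :=
    ⟨⟨G.comp ⟨fun t => (0, t), by fun_prop⟩, hG₀ 0, rfl⟩,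
      fun t => (hG _).trans (F.apply_zero t)⟩
  rw [hp.liftsTo_unique h h₀]
  exact ⟨⟨G.comp ⟨fun t => (1, t), by fun_prop⟩, hG₀ 1, hG₁ 1⟩,
    fun t => (hG _).trans (F.apply_one t)⟩

/-- Small loops lift to loops. -/
theorem liftsTo_self_of_mem_smallSubgroup (hp : IsSemicoveringMap p) {x : X} {γ : Path x x}
    (hγ : FundamentalGroup.fromPath (Path.Homotopic.Quotient.mk γ) ∈ smallSubgroup x) {e : Y}
    (he : p e = x) : γ.LiftsTo p e e := by
  obtain ⟨φ, heφ, hφ⟩ := hp.isLocalHomeomorph e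
  have hφ' : ∀ z, φ z = p z := fun z => (congrFun hφ z).symm
  have hx : x ∈ φ.target := by rw [← he, ← hφ']; exact φ.map_source heφ
  simp only [smallSubgroup, Subgroup.mem_iInf] at hγ
  obtain ⟨h, hh⟩ := hγ φ.target φ.open_target hx
  induction h using Path.Homotopic.Quotient.ind with | mk β =>
  refine hp.liftsTo_of_homotopic (γ₀ := β.map continuous_subtype_val) ?_
    (Path.Homotopic.Quotient.exact hh)
  have hs : φ.symm x = e := by rw [← he, ← hφ', φ.left_inv heφ]
  refine ⟨⟨⟨fun t => φ.symm (β t), ?_⟩, ?_, ?_⟩, fun t => ?_⟩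
  · exact φ.continuousOn_symm.comp_continuous (by fun_prop) (fun t => (β t).2)
  · simpa using hs
  · simpa using hs
  · exact (hφ' _).symm.trans (φ.right_inv (β t).2)

/-- Loops with class in the small generated subgroup lift to loops. -/
theorem liftsTo_self_of_mem_smallGeneratedSubgroup (hp : IsSemicoveringMap p) {x : X} {γ : Path x x}
    (hγ : FundamentalGroup.fromPath (Path.Homotopic.Quotient.mk γ) ∈ smallGeneratedSubgroup x)
    {e : Y} (he : p e = x) : γ.LiftsTo p e e := by
  suffices ∀ g ∈ smallGeneratedSubgroup x, ∃ γ : Path x x,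
      FundamentalGroup.fromPath (Path.Homotopic.Quotient.mk γ) = g ∧
        ∀ e, p e = x → γ.LiftsTo p e e by
    obtain ⟨γ', hγ', h⟩ := this _ hγ
    exact hp.liftsTo_of_homotopic (h e he) (Path.Homotopic.Quotient.exact hγ')
  intro g hg
  induction hg using Subgroup.closure_induction with
  | mem g hg =>
    obtain ⟨y, α, β, hβ, rfl⟩ := hg
    refine ⟨_, rfl, fun e he => ?_⟩
    obtain ⟨e', h⟩ := hp.exists_liftsTo α he
    exact (h.trans (hp.liftsTo_self_of_mem_smallSubgroup hβ h.symm.source_eq)).trans h.symm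
  | one => exact ⟨Path.refl x, rfl, fun e => .refl⟩
  | mul g g' _ _ h h' =>
    obtain ⟨γ, rfl, h⟩ := h
    obtain ⟨γ', rfl, h'⟩ := h'
    -- Multiplication here is concatenation in reverse order.
    exact ⟨γ'.trans γ, rfl, fun e he => (h' e he).trans (h e he)⟩
  | inv g _ h =>
    obtain ⟨γ, rfl, h⟩ := h
    exact ⟨γ.symm, rfl, fun e he => (h e he).symm⟩

theorem surjective [PathConnectedSpace X] [Nonempty Y] (hp : IsSemicoveringMap p) :
    Function.Surjective p := by
  intro x
  obtain ⟨e⟩ := ‹Nonempty Y›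
  obtain ⟨e', h⟩ := hp.exists_liftsTo (PathConnectedSpace.somePath (p e) x) rfl
  exact ⟨e', h.symm.source_eq⟩

end IsSemicoveringMap

/-- Makes path components of open sets of `Y` open, as sheets must be. -/
theorem IsLocalHomeomorph.locallyPathConnectedSpace {X Y : Type*} [TopologicalSpace X]
    [TopologicalSpace Y] [LocallyPathConnectedSpace X] {f : Y → X} (hf : IsLocalHomeomorph f) :
    LocallyPathConnectedSpace Y := by
  refine ⟨fun y => Filter.hasBasis_self.2 fun t ht => ?_⟩
  obtain ⟨φ, hy, rfl⟩ := hf y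
  have ht' := φ.image_mem_nhds hy (Filter.inter_mem ht (φ.open_source.mem_nhds hy))
  obtain ⟨s, ⟨hs, hsc⟩, hst⟩ := (path_connected_basis (φ y)).mem_iff.1 ht'
  have hsφ : s ⊆ φ.target := by
    rintro _ hz
    obtain ⟨w, hw, rfl⟩ := hst hz
    exact φ.map_source hw.2
  refine ⟨φ.symm '' s, ?_, hsc.image' (φ.continuousOn_symm.mono hsφ), ?_⟩
  · simpa [hy] using φ.symm.image_mem_nhds (φ.map_source hy) hs
  · rintro _ ⟨z, hz, rfl⟩
    obtain ⟨w, hw, rfl⟩ := hst hz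
    rw [φ.left_inv hw.2]
    exact hw.1

theorem IsSemicoveringMap.isCoveringMap {X Y : Type*} [TopologicalSpace X] [TopologicalSpace Y]
    {p : C(Y, X)} [PathConnectedSpace X] [LocallyPathConnectedSpace X]
    (hp : IsSemicoveringMap p) (hX : SemilocallySmallGenerated X) : IsCoveringMap p := by
  cases isEmpty_or_nonempty Y
  · exact .of_isEmpty _
  intro x
  have := hp.isLocalHomeomorph.locallyPathConnectedSpace
  have hloc : ∀ e ∈ p ⁻¹' {x}, ∃ φ : OpenPartialHomeomorph Y X, e ∈ φ.source ∧ ⇑φ = ⇑p :=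
    fun e _ => let ⟨φ, h, h'⟩ := hp.isLocalHomeomorph e; ⟨φ, h, h'.symm⟩
  have : DiscreteTopology (p ⁻¹' {x}) := (IsDiscrete.of_openPartialHomeomorph p subset_rfl hloc).1
  have : Nonempty (p ⁻¹' {x}) := let ⟨e, he⟩ := hp.surjective x; ⟨⟨e, he⟩⟩
  obtain ⟨U, hxU, hU, hUsg⟩ := hX x
  let V := pathComponentIn U x
  have hV : IsOpen V := hU.pathComponentIn x
  have hxV : x ∈ V := mem_pathComponentIn_self hxU
  have hVconn : IsPathConnected V := isPathConnected_pathComponentIn hxU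
  let S (e : p ⁻¹' {x}) : Set Y := pathComponentIn (p ⁻¹' V) e
  have hS e : IsOpen (S e) := (hV.preimage p.continuous).pathComponentIn _
  have surj e : (S e).SurjOn p V := by
    intro v hv
    obtain ⟨γ, hγ⟩ := hVconn.joinedIn x hxV v hv
    obtain ⟨z, δ, hδ⟩ := hp.exists_liftsTo γ e.2
    exact ⟨z, ⟨δ, fun t => by simpa [hδ] using hγ t⟩, Path.LiftsTo.source_eq (.symm ⟨δ, hδ⟩)⟩
  have exhaustive : p ⁻¹' V ⊆ ⋃ e, S e := by
    intro z hz
    obtain ⟨γ, hγ⟩ := hVconn.joinedIn _ hz x hxV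
    obtain ⟨e, δ, hδ⟩ := hp.exists_liftsTo γ (e := z) rfl
    refine Set.mem_iUnion.2 ⟨⟨e, Path.LiftsTo.source_eq (.symm ⟨δ, hδ⟩)⟩, ?_⟩
    exact JoinedIn.symm ⟨δ, fun t => by simpa [hδ] using hγ t⟩
  have inj e : (S e).InjOn p := by
    obtain ⟨e, rfl⟩ := e
    rintro z ⟨δ, hδ⟩ z' ⟨δ', hδ'⟩ hzz'
    let γ := δ.map p.continuous
    let γ' : Path (p e) (p z) := (δ'.map p.continuous).cast rfl hzz'
    have hγ : γ.LiftsTo p e z := ⟨δ, fun _ => rfl⟩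
    have hγ' : γ'.LiftsTo p e z' := ⟨δ', fun _ => rfl⟩
    have hloop : ∀ t, (γ.trans γ'.symm) t ∈ U := by
      intro t
      rw [Path.trans_apply]
      split_ifs
      · exact pathComponentIn_subset (hδ _)
      · exact pathComponentIn_subset (hδ' _)
    have hmem : FundamentalGroup.fromPath (Path.Homotopic.Quotient.mk (γ.trans γ'.symm)) ∈
        smallGeneratedSubgroup (p e) := by
      refine hUsg ⟨FundamentalGroup.fromPath (Path.Homotopic.Quotient.mk
        ⟨⟨fun t => ⟨_, hloop t⟩, by fun_prop⟩, ?_, ?_⟩), rfl⟩ <;> simp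
    -- The lift of the loop passes through `z` and closes up at `e`, so `γ'` lifts from `e` to `z`
    -- as well as to `z'`.
    obtain ⟨w, hw⟩ := hp.exists_liftsTo γ'.symm (e := z) rfl
    obtain rfl := hp.liftsTo_unique (hγ.trans hw)
      (hp.liftsTo_self_of_mem_smallGeneratedSubgroup hmem rfl)
    exact hp.liftsTo_unique (γ := γ') (by simpa using hw.symm) hγ'
  have disj : Pairwise (Function.onFun Disjoint S) := by
    intro e e' hne
    refine Set.disjoint_left.2 fun z hz hz' => hne ?_
    refine Subtype.ext (inj e (mem_pathComponentIn_self ?_) (hz.trans hz'.symm) ?_)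
    · exact hz.source_mem
    · exact e.2.trans e'.2.symm
  refine .to_isEvenlyCovered_preimage (.of_trivialization (t := hV.trivializationDiscrete S V
    (fun e W hW => ⟨fun h => (h.preimage p.continuous).inter (hS e), fun h => ?_⟩)
    inj surj disj exhaustive) hxV)
  -- By surjectivity of the sheet, `W` is the image of the part of the sheet over it.
  convert hp.isLocalHomeomorph.isOpenMap _ h
  refine subset_antisymm (fun w hw => ?_) (by rintro _ ⟨z, hz, rfl⟩; exact hz.1)
  obtain ⟨z, hz, rfl⟩ := surj e (hW hw)
  exact ⟨z, ⟨hw, hz⟩, rfl⟩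

theorem theorem4p4 {X : Type*} [TopologicalSpace X] [ConnectedSpace X]
    [LocallyPathConnectedSpace X] (hX : SemilocallySmallGenerated X)
    {Y : Type*} [TopologicalSpace Y] (p : C(Y, X)) (hp : IsSemicoveringMap p) :
    IsCoveringMap p ∧ (Nonempty Y → Function.Surjective p) := by
  have : PathConnectedSpace X := pathConnectedSpace_iff_connectedSpace.2 inferInstance
  exact ⟨hp.isCoveringMap hX, fun _ => hp.surjective⟩
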